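/- For a well quasi-order $A$, let $\mathrm{Inco}(A)$ be the tree (forest) of non-empty finite sequences of pairwise incomparable elements of $A$, in which the children of a sequence $(x_1,\dots,x_k)$ are the sequences $(x_1,\dots,x_k,y)$ in $\mathrm{Inco}(A)$. The rank of a node $s$ is the ordinal $r(s)=\sup\{r(t)+1 : t \text{ a child of } s\}$ (so $r(s)=0$ at a leaf), and the width of $A$ is $w(A)=\sup\{r(s)+1 : s\in \mathrm{Inco}(A)\}$. Let $\oplus$ denote the natural (Hessenberg) sum of ordinals, let $+$ denote the usual ordinal sum, and for an ordinal $\alpha\ge 1$ let $\alpha-1$ denote the left difference, i.e. the unique ordinal with $1+(\alpha-1)=\alpha$. **Theorem.** Let $n\ge 2$, let $\alpha_1\ge\dots\ge\alpha_n>0$ be ordinals, and let $X=\omega^{\alpha_1}\times\dots\times\omega^{\alpha_n}$ be the Cartesian product, ordered componentwise. Then $w(X)=\omega^{\eta}$ with $$\eta=\alpha_1\oplus\bigl((\alpha_2\oplus\dots\oplus\alpha_n)-1\bigr).$$ Explicitly: 1. If $\alpha_1,\dots,\alpha_n$ are all finite, then $\alpha_1+\dots+\alpha_n=\alpha_1\oplus\dots\oplus\alpha_n$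 and $\eta=(\alpha_1+\dots+\alpha_n)-1$. 2. If $\alpha_1$ is infinite and $\alpha_2,\dots,\alpha_n$ are finite, then $\alpha_2+\dots+\alpha_n=\alpha_2\oplus\dots\oplus\alpha_n$ and $\eta=\alpha_1+\bigl((\alpha_2+\dots+\alpha_n)-1\bigr)$. 3. If at least two of the $\alpha_i$ are infinite, then $\eta=\alpha_1\oplus\dots\oplus\alpha_n$. -/

import Mathlib

universe u

/-- The (Hessenberg) natural sum `a ⊕ b` of two ordinals: the least ordinal that is strictly
greater than every `a' ⊕ b` with `a' < a` and every `a ⊕ b'` with `b' < b`. -/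
noncomputable def natAdd (a b : Ordinal.{u}) : Ordinal.{u} :=
  max (⨆ x : Set.Iio a, Order.succ (natAdd x.1 b)) (⨆ x : Set.Iio b, Order.succ (natAdd a x.1))
termination_by (a, b)
decreasing_by all_goals cases x; decreasing_tactic

/-- The natural sum `a₁ ⊕ ⋯ ⊕ aₖ` of a finite list of ordinals. -/
noncomputable def natSum (l : List Ordinal.{u}) : Ordinal.{u} :=
  l.foldr natAdd 0

section Width

variable (A : Type u) [Preorder A]

/-- The nodes of the tree `Inco(A)`: the non-empty finite sequences of pairwise incomparable
elements of `A`. A sequence `(x₁, …, xₖ)` is represented by the list `[xₖ, …, x₁]`, so that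
appending an element to the sequence is `List.cons`. -/
def Inco : Type u :=
  {l : List A // l ≠ [] ∧ l.Pairwise (IncompRel (· ≤ ·))}

variable {A}

/-- `t` is a child of `s` in the tree `Inco(A)`: it extends the sequence `s` by one element. -/
def Inco.IsChild (t s : Inco A) : Prop :=
  ∃ y : A, t.1 = y :: s.1

/-- For a well quasi-order `A` the tree `Inco(A)` has no infinite branches. -/
instance Inco.isWellFounded_isChild [WellQuasiOrderedLE A] :
    IsWellFounded (Inco A) Inco.IsChild := by
  rw [isWellFounded_iff, wellFounded_iff_isEmpty_descending_chain]
  refine ⟨fun ⟨f, h⟩ => ?_⟩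
  choose y hy using h
  have hmem : ∀ m k, y m ∈ (f (m + k + 1)).1 := by
    intro m k
    induction k with
    | zero => rw [hy]; simp
    | succ k ih => rw [← add_assoc m k 1, hy (m + k + 1)]; exact List.mem_cons_of_mem _ ih
  obtain ⟨m, n, hmn, hle⟩ := (wellQuasiOrdered_le : @WellQuasiOrdered A (· ≤ ·)) y
  obtain ⟨k, rfl⟩ := Nat.exists_eq_add_of_lt hmn
  have hp := (f (m + k + 1 + 1)).2.2
  rw [hy, List.pairwise_cons] at hp
  exact (hp.1 _ (hmem m k)).2 hle

variable (A)

/-- The width `w(A)` of a well quasi-order `A`: the rank of the tree `Inco(A)`, that is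
`sup {r(s) + 1 : s ∈ Inco(A)}`, where the rank of a node is
`r(s) = sup {r(t) + 1 : t a child of s}`. -/
noncomputable def wqoWidth [WellQuasiOrderedLE A] : Ordinal.{u} :=
  ⨆ s : Inco A, Order.succ (IsWellFounded.rank Inco.IsChild s)

end Width

/-! ### Natural sums and their closure below powers of `ω`. -/

section NatAdd

open Ordinal

/-! Both bounds on the width of the box `∏ ω ^ α i` are proved by well-founded induction on the
tuple `α`, by cutting the box into slabs along a coordinate.

Upper bound: after a first element `x`, every later `y` satisfies `y i < x i` for some `i`. As `x i
< ω ^ c * k` with `c < α i` and `k` finite, these `y` lie in finitely many slabs, each a translated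
part of the box with `α i` lowered to `c`. A finite union has width at most the natural sum of the
widths, and powers of `ω` are closed under natural sums (`natAdd_lt_omega0_opow`).

Lower bound: `k` slabs of thickness `ω ^ c` can be played one after the other, from the top down.
Raising another unbounded coordinate above everything already played makes each new slab
incomparable with the past, so widths add up to `ω ^ e * k` (`WidthAtLeast.slabs`), where `ω ^ e` is
the width of one slab.

Hence the exponent is the least strict upper bound of the exponents obtained by lowering one
coordinate, with value `0` when fewer than two coordinates are nonzero (a chain). This is the
recursion of the natural sum with a different base. The base costs one unit as long as at most one
coordinate is infinite; the unit is absorbed at limits once two are. The recursion is verified in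
`prodWidthExp_update_lt` and `exists_le_prodWidthExp_update`. -/

theorem lt_natAdd_iff {a b c : Ordinal.{u}} :
    c < natAdd a b ↔ (∃ a' < a, c ≤ natAdd a' b) ∨ ∃ b' < b, c ≤ natAdd a b' := by
  rw [natAdd, lt_max_iff, Ordinal.lt_iSup_iff, Ordinal.lt_iSup_iff]
  simp

theorem natAdd_le_iff {a b c : Ordinal.{u}} :
    natAdd a b ≤ c ↔ (∀ a' < a, natAdd a' b < c) ∧ ∀ b' < b, natAdd a b' < c := by
  rw [← not_lt, lt_natAdd_iff]
  push Not
  rfl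

theorem natAdd_lt_natAdd_left {a a' : Ordinal.{u}} (h : a' < a) (b : Ordinal.{u}) :
    natAdd a' b < natAdd a b :=
  lt_natAdd_iff.2 (.inl ⟨a', h, le_rfl⟩)

theorem natAdd_lt_natAdd_right (a : Ordinal.{u}) {b b' : Ordinal.{u}} (h : b' < b) :
    natAdd a b' < natAdd a b :=
  lt_natAdd_iff.2 (.inr ⟨b', h, le_rfl⟩)

theorem natAdd_le_natAdd_right (a : Ordinal.{u}) {b b' : Ordinal.{u}} (h : b' ≤ b) :
    natAdd a b' ≤ natAdd a b :=
  (strictMono_of_le_iff_le fun _ _ =>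
    (StrictMono.le_iff_le fun _ _ => natAdd_lt_natAdd_right a).symm).monotone h

theorem natAdd_comm (a b : Ordinal.{u}) : natAdd a b = natAdd b a := by
  induction a using WellFoundedLT.induction generalizing b with
  | ind a iha =>
  induction b using WellFoundedLT.induction with
  | ind b ihb =>
  refine eq_of_forall_lt_iff fun c => ?_
  rw [lt_natAdd_iff, lt_natAdd_iff, or_comm]
  refine or_congr (exists_congr fun x => and_congr_right fun h => ?_)
    (exists_congr fun x => and_congr_right fun h => ?_)
  · rw [ihb x h]
  · rw [iha x h]

@[simp]
theorem natAdd_zero (a : Ordinal.{u}) : natAdd a 0 = a := by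
  induction a using WellFoundedLT.induction with
  | ind a ih =>
  refine eq_of_forall_lt_iff fun c => ?_
  rw [lt_natAdd_iff]
  constructor
  · rintro (⟨x, hx, hc⟩ | ⟨x, hx, -⟩)
    · exact (hc.trans_eq (ih x hx)).trans_lt hx
    · simp at hx
  · exact fun hc => .inl ⟨c, hc, (ih c hc).ge⟩

@[simp]
theorem zero_natAdd (a : Ordinal.{u}) : natAdd 0 a = a := by rw [natAdd_comm, natAdd_zero]

theorem natAdd_add_one (a b : Ordinal.{u}) : natAdd a (b + 1) = natAdd a b + 1 := by
  induction a using WellFoundedLT.induction with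
  | ind a ih =>
  refine le_antisymm (natAdd_le_iff.2 ⟨fun x hx => ?_, fun x hx => ?_⟩) ?_
  · rw [ih x hx]
    exact Order.lt_add_one_iff.2 (Order.add_one_le_iff.2 (natAdd_lt_natAdd_left hx b))
  · exact Order.lt_add_one_iff.2 (natAdd_le_natAdd_right a (Order.lt_add_one_iff.1 hx))
  · exact Order.add_one_le_iff.2 (natAdd_lt_natAdd_right a (Order.lt_add_one_iff.2 le_rfl))

theorem add_one_natAdd (a b : Ordinal.{u}) : natAdd (a + 1) b = natAdd a b + 1 := by
  rw [natAdd_comm, natAdd_add_one, natAdd_comm]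

theorem natAdd_natCast (a : Ordinal.{u}) (m : ℕ) : natAdd a m = a + m := by
  induction m with
  | zero => simp
  | succ m ih => rw [Nat.cast_succ, natAdd_add_one, ih, add_assoc]

theorem le_natAdd_left (a b : Ordinal.{u}) : a ≤ natAdd b a := by
  have h : StrictMono (natAdd b) := fun _ _ => natAdd_lt_natAdd_right b
  exact h.le_apply

theorem le_natAdd_right (a b : Ordinal.{u}) : a ≤ natAdd a b :=
  (le_natAdd_left a b).trans_eq (natAdd_comm b a)

/-- Lowering one argument lowers its quotient and remainder by `ω ^ e` lexicographically. Since
natural sums of remainders stay below `ω ^ e`, the right-hand side then drops strictly, as the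
recursion for `natAdd` demands. -/
theorem natAdd_opow_mul_add_le {e : Ordinal.{u}}
    (he : ∀ r s : Ordinal.{u}, r < ω ^ e → s < ω ^ e → natAdd r s < ω ^ e) (m n : ℕ)
    (r s : Ordinal.{u}) (hr : r < ω ^ e) (hs : s < ω ^ e) :
    natAdd (ω ^ e * m + r) (ω ^ e * n + s) ≤ ω ^ e * (m + n : ℕ) + natAdd r s := by
  have aux : ∀ (x : Ordinal.{u}) (k : ℕ) (t : Ordinal.{u}), t < ω ^ e → x < ω ^ e * k + t →
      ∃ (k' : ℕ) (t' : Ordinal.{u}), t' < ω ^ e ∧ x = ω ^ e * k' + t' ∧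
        (k' < k ∨ k' = k ∧ t' < t) := by
    intro x k t ht hx
    have h0 : (ω ^ e : Ordinal.{u}) ≠ 0 := opow_ne_zero _ omega0_ne_zero
    have hk : x < ω ^ e * (k + 1 : ℕ) := by
      refine hx.trans ?_
      rw [Nat.cast_succ, mul_add_one]
      exact (add_lt_add_iff_left _).2 ht
    obtain ⟨k', hk'⟩ := lt_omega0.1 ((lt_mul_iff_div_lt h0).1 hk |>.trans (natCast_lt_omega0 _))
    have hx' := (div_add_mod x (ω ^ e)).symm
    refine ⟨k', x % ω ^ e, mod_lt _ h0, by rwa [hk'] at hx', ?_⟩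
    have := (lt_mul_iff_div_lt h0).1 hk
    rw [hk', Nat.cast_lt, Nat.lt_succ_iff] at this
    refine this.lt_or_eq.imp id fun h => ⟨h, ?_⟩
    rw [hk', h] at hx'
    rw [hx'] at hx
    exact (add_lt_add_iff_left _).1 hx
  generalize hx : ω ^ e * (m : Ordinal.{u}) + r = x
  generalize hy : ω ^ e * (n : Ordinal.{u}) + s = y
  induction x using WellFoundedLT.induction generalizing m n r s y with
  | ind x ihx =>
  induction y using WellFoundedLT.induction generalizing m n r s with
  | ind y ihy =>
  have step : ∀ (k k' : ℕ) (t t' : Ordinal.{u}), t' < ω ^ e → (k' < k ∨ k' = k ∧ t' < t) →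
      ω ^ e * k' + t' < ω ^ e * (k : Ordinal.{u}) + t := by
    rintro k k' t t' ht' (hk | ⟨rfl, ht⟩)
    · calc ω ^ e * k' + t' < ω ^ e * k' + ω ^ e := (add_lt_add_iff_left _).2 ht'
        _ = ω ^ e * (k' + 1 : ℕ) := by rw [Nat.cast_succ, mul_add_one]
        _ ≤ ω ^ e * k := by gcongr; exact hk
        _ ≤ _ := le_self_add
    · exact (add_lt_add_iff_left _).2 ht
  refine natAdd_le_iff.2 ⟨fun z hz => ?_, fun z hz => ?_⟩
  · obtain ⟨m', r', hr', rfl, h⟩ := aux z m r hr (hx ▸ hz)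
    refine (ihx _ hz m' n r' s hr' hs rfl _ hy).trans_lt (step _ _ _ _ (he _ _ hr' hs) ?_)
    exact h.imp (by omega) fun h => ⟨by omega, natAdd_lt_natAdd_left h.2 s⟩
  · obtain ⟨n', s', hs', rfl, h⟩ := aux z n s hs (hy ▸ hz)
    refine (ihy _ hz m n' r s' hr hs' hx rfl).trans_lt (step _ _ _ _ (he _ _ hr hs') ?_)
    exact h.imp (by omega) fun h => ⟨by omega, natAdd_lt_natAdd_right r h.2⟩

theorem natAdd_lt_omega0_opow {e a b : Ordinal.{u}} (ha : a < ω ^ e) (hb : b < ω ^ e) :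
    natAdd a b < ω ^ e := by
  induction e using WellFoundedLT.induction generalizing a b with
  | ind e ih =>
  obtain rfl | he := eq_or_ne e 0
  · rw [opow_zero, Order.lt_one_iff] at ha hb
    simp [ha, hb]
  obtain ⟨c, hc, m, hm⟩ := (lt_omega0_opow he).1 ha
  obtain ⟨d, hd, n, hn⟩ := (lt_omega0_opow he).1 hb
  -- Both ordinals are divided by the same power `ω ^ max c d`, where the induction hypothesis
  -- controls the remainders.
  have hf : max c d < e := max_lt hc hd
  have h0 : (ω ^ max c d : Ordinal.{u}) ≠ 0 := opow_ne_zero _ omega0_ne_zero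
  have aux : ∀ (f x : Ordinal.{u}) (k : ℕ), f ≤ max c d → x < ω ^ f * k →
      ∃ (k' : ℕ) (t : Ordinal.{u}), t < ω ^ max c d ∧ x = ω ^ max c d * k' + t := by
    intro f x k hf hx
    have hx' : x < ω ^ max c d * k :=
      hx.trans_le (mul_le_mul_left (opow_le_opow_right omega0_pos hf) _)
    obtain ⟨k', hk'⟩ := lt_omega0.1 ((lt_mul_iff_div_lt h0).1 hx' |>.trans (natCast_lt_omega0 _))
    exact ⟨k', x % ω ^ max c d, mod_lt _ h0, by rw [← hk', div_add_mod]⟩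
  obtain ⟨m', r, hr, rfl⟩ := aux c a m (le_max_left _ _) hm
  obtain ⟨n', s, hs, rfl⟩ := aux d b n (le_max_right _ _) hn
  refine (natAdd_opow_mul_add_le (fun r s => ih _ hf) m' n' r s hr hs).trans_lt ?_
  exact opow_mul_add_lt_opow (natCast_lt_omega0 _) (ih _ hf hr hs) hf

end NatAdd
universe v w w'

/-! ### Rank bounds for incomparability trees inside a set. -/

section WidthBounds

variable {A : Type w} {B : Type w'} [Preorder A] [Preorder B]

/-- The elements of `S` that are incomparable with `x`. -/
def incompIn (S : Set A) (x : A) : Set A :=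
  {y ∈ S | IncompRel (· ≤ ·) x y}

/-- The tree of sequences of pairwise incomparable elements of `S` has rank at least `o`. -/
def WidthAtLeast (o : Ordinal.{v}) (S : Set A) : Prop :=
  ∀ o' < o, ∃ x ∈ S, WidthAtLeast o' (incompIn S x)
termination_by o

/-- The tree of sequences of pairwise incomparable elements of `S` has rank at most `o`. -/
def WidthAtMost (o : Ordinal.{v}) (S : Set A) : Prop :=
  ∀ x ∈ S, ∃ o', ∃ _ : o' < o, WidthAtMost o' (incompIn S x)
termination_by o

theorem widthAtLeast_iff {o : Ordinal.{v}} {S : Set A} :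
    WidthAtLeast o S ↔ ∀ o' < o, ∃ x ∈ S, WidthAtLeast o' (incompIn S x) := by
  rw [WidthAtLeast]

theorem widthAtMost_iff {o : Ordinal.{v}} {S : Set A} :
    WidthAtMost o S ↔ ∀ x ∈ S, ∃ o' < o, WidthAtMost o' (incompIn S x) := by
  rw [WidthAtMost]
  simp

theorem WidthAtLeast.of_map {o : Ordinal.{v}} {S : Set A} {T : Set B} (h : WidthAtLeast o S)
    (f : A → B) (hST : Set.MapsTo f S T)
    (hf : ∀ x ∈ S, ∀ y ∈ S, IncompRel (· ≤ ·) x y → IncompRel (· ≤ ·) (f x) (f y)) :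
    WidthAtLeast o T := by
  induction o using WellFoundedLT.induction generalizing S T with
  | ind o ih =>
  rw [widthAtLeast_iff] at h ⊢
  intro o' ho'
  obtain ⟨x, hx, hr⟩ := h o' ho'
  exact ⟨f x, hST hx, ih o' ho' hr (fun y hy => ⟨hST hy.1, hf x hx y hy.1 hy.2⟩)
    fun y hy z hz => hf y hy.1 z hz.1⟩

theorem WidthAtLeast.mono {o : Ordinal.{v}} {S T : Set A} (h : WidthAtLeast o S) (hST : S ⊆ T) :
    WidthAtLeast o T :=
  h.of_map id hST fun _ _ _ _ h => h

theorem WidthAtMost.of_map {o : Ordinal.{v}} {S : Set A} {T : Set B} (h : WidthAtMost o T)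
    (f : A → B) (hST : Set.MapsTo f S T)
    (hf : ∀ x ∈ S, ∀ y ∈ S, IncompRel (· ≤ ·) x y → IncompRel (· ≤ ·) (f x) (f y)) :
    WidthAtMost o S := by
  induction o using WellFoundedLT.induction generalizing S T with
  | ind o ih =>
  rw [widthAtMost_iff] at h ⊢
  intro x hx
  obtain ⟨o', ho', hr⟩ := h (f x) (hST hx)
  exact ⟨o', ho', ih o' ho' hr (fun y hy => ⟨hST hy.1, hf x hx y hy.1 hy.2⟩)
    fun y hy z hz => hf y hy.1 z hz.1⟩

theorem WidthAtMost.mono {o : Ordinal.{v}} {S T : Set A} (h : WidthAtMost o T) (hST : S ⊆ T) :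
    WidthAtMost o S :=
  h.of_map id hST fun _ _ _ _ h => h

/-- Each move lies in `S` or in `T` and strictly lowers the bound for that part without spoiling the
other, which is exactly the recursion defining `natAdd`. -/
theorem WidthAtMost.union {a b : Ordinal.{v}} {S T : Set A} (hS : WidthAtMost a S)
    (hT : WidthAtMost b T) : WidthAtMost (natAdd a b) (S ∪ T) := by
  induction a using WellFoundedLT.induction generalizing b S T with
  | ind a iha =>
  induction b using WellFoundedLT.induction generalizing S T with
  | ind b ihb =>
  have hres : ∀ x, incompIn (S ∪ T) x = incompIn S x ∪ incompIn T x := fun x => by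
    ext y
    exact or_and_right
  rw [widthAtMost_iff]
  rintro x (hx | hx)
  · obtain ⟨a', ha', h⟩ := widthAtMost_iff.1 hS x hx
    refine ⟨_, natAdd_lt_natAdd_left ha' b, ?_⟩
    rw [hres]
    exact iha a' ha' h (hT.mono fun y hy => hy.1)
  · obtain ⟨b', hb', h⟩ := widthAtMost_iff.1 hT x hx
    refine ⟨_, natAdd_lt_natAdd_right a hb', ?_⟩
    rw [hres]
    exact ihb b' hb' (hS.mono fun y hy => hy.1) h

theorem widthAtMost_zero_empty : WidthAtMost (0 : Ordinal.{v}) (∅ : Set A) :=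
  widthAtMost_iff.2 fun _ hx => hx.elim

theorem exists_widthAtMost_biUnion {ι : Type*} {e : Ordinal.{v}} (s : Finset ι) (S : ι → Set A)
    (h : ∀ i ∈ s, ∃ o < Ordinal.omega0 ^ e, WidthAtMost o (S i)) :
    ∃ o < Ordinal.omega0 ^ e, WidthAtMost o (⋃ i ∈ s, S i) := by
  classical
  induction s using Finset.induction_on with
  | empty =>
    refine ⟨0, Ordinal.opow_pos _ Ordinal.omega0_pos, ?_⟩
    simpa using widthAtMost_zero_empty
  | insert i s _ ih =>
    obtain ⟨o, ho, hS⟩ := h i (Finset.mem_insert_self i s)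
    obtain ⟨o', ho', hS'⟩ := ih fun j hj => h j (Finset.mem_insert_of_mem hj)
    refine ⟨natAdd o o', natAdd_lt_omega0_opow ho ho', ?_⟩
    rw [Finset.set_biUnion_insert]
    exact hS.union hS'

/-- After any finite play in `P`, a tree of rank `b` is still available in `U`. -/
theorem WidthAtLeast.add {a b : Ordinal.{v}} {P U : Set A} (hP : WidthAtLeast a P) (hPU : P ⊆ U)
    (h : ∀ F : Finset A, ↑F ⊆ P → WidthAtLeast b {x ∈ U | ∀ p ∈ F, IncompRel (· ≤ ·) p x}) :
    WidthAtLeast (b + a) U := by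
  classical
  induction a using WellFoundedLT.induction generalizing P U with
  | ind a ih =>
  rw [widthAtLeast_iff]
  intro c hc
  obtain hcb | hbc := lt_or_ge c b
  -- Below `b` no move in `P` is needed; from `b` on, write `c = b + a'` and spend one move of `P`.
  -- The tree played last is the left summand.
  · exact widthAtLeast_iff.1 ((h ∅ (by simp)).mono fun x hx => hx.1) c hcb
  obtain ⟨a', rfl⟩ := exists_add_of_le hbc
  have ha' : a' < a := (add_lt_add_iff_left b).1 hc
  obtain ⟨x, hx, hr⟩ := widthAtLeast_iff.1 hP a' ha'
  refine ⟨x, hPU hx, ih a' ha' hr (fun y hy => ⟨hPU hy.1, hy.2⟩) fun F hF => ?_⟩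
  refine (h (insert x F) ?_).mono ?_
  · rw [Finset.coe_insert]
    exact Set.insert_subset hx fun y hy => (hF hy).1
  · rintro y ⟨hy, hyF⟩
    exact ⟨⟨hy, hyF x (Finset.mem_insert_self x F)⟩,
      fun p hp => hyF p (Finset.mem_insert_of_mem hp)⟩

end WidthBounds

/-! ### Comparison with the rank defining `wqoWidth`. -/

section WqoWidth

variable {A : Type u} [Preorder A]

/-- The elements incomparable with all elements of `l`. -/
def incompSet (l : List A) : Set A :=
  {y | ∀ x ∈ l, IncompRel (· ≤ ·) x y}

theorem incompSet_cons (x : A) (l : List A) :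
    incompSet (x :: l) = incompIn (incompSet l) x := by
  ext y
  simp [incompSet, incompIn, and_comm]

theorem incompSet_nil : incompSet ([] : List A) = Set.univ := by
  simp [incompSet]

theorem pairwise_cons_of_mem_incompSet {l : List A} {x : A}
    (hl : l.Pairwise (IncompRel (· ≤ ·))) (hx : x ∈ incompSet l) :
    (x :: l).Pairwise (IncompRel (· ≤ ·)) :=
  List.pairwise_cons.2 ⟨fun y hy => (hx y hy).symm, hl⟩

variable [WellQuasiOrderedLE A]

theorem WidthAtLeast.le_rank {o : Ordinal.{u}} (s : Inco A)
    (h : WidthAtLeast o (incompSet s.1)) : o ≤ IsWellFounded.rank Inco.IsChild s := by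
  induction o using WellFoundedLT.induction generalizing s with
  | ind o ih =>
  refine le_of_forall_lt fun o' ho' => ?_
  obtain ⟨x, hx, hr⟩ := widthAtLeast_iff.1 h o' ho'
  rw [← incompSet_cons] at hr
  let t : Inco A := ⟨x :: s.1, by simp, pairwise_cons_of_mem_incompSet s.2.2 hx⟩
  exact (ih o' ho' t hr).trans_lt (IsWellFounded.rank_lt_of_rel ⟨x, rfl⟩)

theorem WidthAtMost.rank_le {o : Ordinal.{u}} (s : Inco A)
    (h : WidthAtMost o (incompSet s.1)) : IsWellFounded.rank Inco.IsChild s ≤ o := by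
  induction o using WellFoundedLT.induction generalizing s with
  | ind o ih =>
  rw [IsWellFounded.rank_eq]
  refine Ordinal.iSup_le ?_
  rintro ⟨t, x, ht⟩
  have hx : x ∈ incompSet s.1 := by
    have := t.2.2
    rw [ht, List.pairwise_cons] at this
    exact fun y hy => (this.1 y hy).symm
  obtain ⟨o', ho', hr⟩ := widthAtMost_iff.1 h x hx
  rw [← incompSet_cons, ← ht] at hr
  exact Order.succ_le_of_lt ((ih o' ho' t hr).trans_lt ho')

theorem WidthAtLeast.le_wqoWidth {o : Ordinal.{u}} (h : WidthAtLeast o (Set.univ : Set A)) :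
    o ≤ wqoWidth A := by
  refine le_of_forall_lt fun o' ho' => ?_
  obtain ⟨x, hx, hr⟩ := widthAtLeast_iff.1 h o' ho'
  rw [← incompSet_nil, ← incompSet_cons] at hr
  let t : Inco A := ⟨[x], by simp, by simp⟩
  exact (Order.lt_succ_of_le (WidthAtLeast.le_rank t hr)).trans_le
    (Ordinal.le_iSup (fun s : Inco A => Order.succ (IsWellFounded.rank Inco.IsChild s)) t)

theorem WidthAtMost.wqoWidth_le {o : Ordinal.{u}} (h : WidthAtMost o (Set.univ : Set A)) :
    wqoWidth A ≤ o := by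
  -- `o` bounds the rank of the empty sequence, which is not a node of `Inco A`; so every actual
  -- node has a bound strictly below `o`, which pays for the successor in `wqoWidth`.
  have key : ∀ l : List A, l ≠ [] → l.Pairwise (IncompRel (· ≤ ·)) →
      ∃ o' < o, WidthAtMost o' (incompSet l) := by
    intro l hl hp
    induction l with
    | nil => exact absurd rfl hl
    | cons x l ih =>
      rw [List.pairwise_cons] at hp
      have hx : x ∈ incompSet l := fun y hy => (hp.1 y hy).symm
      rw [incompSet_cons]
      obtain rfl | hl' := eq_or_ne l []
      · rw [incompSet_nil]
        exact widthAtMost_iff.1 h x (Set.mem_univ x)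
      · obtain ⟨o', ho', hr⟩ := ih hl' hp.2
        obtain ⟨o'', ho'', hr'⟩ := widthAtMost_iff.1 hr x hx
        exact ⟨o'', ho''.trans ho', hr'⟩
  refine Ordinal.iSup_le fun s => ?_
  obtain ⟨o', ho', hr⟩ := key s.1 s.2.1 s.2.2
  exact Order.succ_le_of_lt ((WidthAtMost.rank_le s hr).trans_lt ho')

end WqoWidth

/-! ### Cutting boxes of ordinals into slabs. -/

section Box

open Ordinal Function

variable {n : ℕ}

/-- The product of the ordinals `b i`, as a set of tuples of ordinals. -/
def ordBox (b : Fin n → Ordinal.{u}) : Set (Fin n → Ordinal.{u}) :=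
  {y | ∀ i, y i < b i}

theorem update_add_le_update_add_iff (c : Ordinal.{u}) (i : Fin n) (x y : Fin n → Ordinal.{u}) :
    update x i (c + x i) ≤ update y i (c + y i) ↔ x ≤ y := by
  rw [update_le_update_iff, add_le_add_iff_left, Pi.le_def]
  refine ⟨fun h j => ?_, fun h => ⟨h i, fun j _ => h j⟩⟩
  obtain rfl | hj := eq_or_ne j i
  · exact h.1
  · exact h.2 j hj

theorem incompRel_update_add_iff (c : Ordinal.{u}) (i : Fin n) (x y : Fin n → Ordinal.{u}) :
    IncompRel (· ≤ ·) (update x i (c + x i)) (update y i (c + y i)) ↔ IncompRel (· ≤ ·) x y := by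
  simp only [IncompRel, update_add_le_update_add_iff]

theorem incompRel_of_lt_of_lt {i j : Fin n} {x y : Fin n → Ordinal.{u}} (hi : x i < y i)
    (hj : y j < x j) : IncompRel (· ≤ ·) x y :=
  ⟨fun h => (h j).not_gt hj, fun h => (h i).not_gt hi⟩

theorem exists_lt_of_incompRel {x y : Fin n → Ordinal.{u}} (h : IncompRel (· ≤ ·) x y) :
    ∃ i j, i ≠ j ∧ y i < x i ∧ x j < y j := by
  obtain ⟨h₁, h₂⟩ := h
  simp only [Pi.le_def, not_forall, not_le] at h₁ h₂
  obtain ⟨i, hi⟩ := h₁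
  obtain ⟨j, hj⟩ := h₂
  exact ⟨i, j, fun h => (h ▸ hi).not_gt hj, hi, hj⟩

theorem widthAtMost_slab {b : Fin n → Ordinal.{u}} {o : Ordinal.{u}} {i : Fin n}
    {c d : Ordinal.{u}} (h : WidthAtMost o (ordBox (update b i d))) :
    WidthAtMost o {y ∈ ordBox b | c ≤ y i ∧ y i < c + d} := by
  have key : ∀ y : Fin n → Ordinal.{u}, c ≤ y i →
      update (update y i (y i - c)) i (c + update y i (y i - c) i) = y := fun y hy => by
    rw [update_self, Ordinal.add_sub_cancel_of_le hy, update_idem, update_eq_self]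
  refine h.of_map (fun y => update y i (y i - c)) ?_ ?_
  · rintro y ⟨hy, hc, hd⟩ j
    obtain rfl | hj := eq_or_ne j i
    · simpa using (Ordinal.sub_lt_of_le hc).2 hd
    · simpa [hj] using hy j
  · rintro x ⟨-, hx, -⟩ y ⟨-, hy, -⟩ hxy
    rw [← incompRel_update_add_iff c i, key x hx, key y hy]
    exact hxy

theorem exists_widthAtMost_slabs {b : Fin n → Ordinal.{u}} {o e : Ordinal.{u}} {i : Fin n}
    {d : Ordinal.{u}} (ho : o < ω ^ e) (h : WidthAtMost o (ordBox (update b i d))) (k : ℕ) :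
    ∃ o' < ω ^ e, WidthAtMost o' {y ∈ ordBox b | y i < d * k} := by
  obtain ⟨o', ho', h'⟩ := exists_widthAtMost_biUnion (Finset.range k)
    (fun m => {y ∈ ordBox b | d * m ≤ y i ∧ y i < d * m + d})
    fun m _ => ⟨o, ho, widthAtMost_slab (c := d * m) h⟩
  refine ⟨o', ho', h'.mono ?_⟩
  rintro y ⟨hy, hk⟩
  simp only [Set.mem_iUnion, Finset.mem_range]
  have hd : d ≠ 0 := by
    rintro rfl
    simp at hk
  have hq := (lt_mul_iff_div_lt hd).1 hk
  obtain ⟨m, hm⟩ := lt_omega0.1 (hq.trans (natCast_lt_omega0 k))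
  rw [hm, Nat.cast_lt] at hq
  refine ⟨m, hq, hy, ?_, ?_⟩
  · rw [← hm]
    exact mul_div_le _ _
  · rw [← hm, ← mul_add_one]
    exact lt_mul_succ_div _ hd

/-- The top slab is played first. The lower `k` slabs, shifted far enough in direction `j`, are
below it in coordinate `i` and above it in coordinate `j`. The limit hypothesis on `b j` leaves room
above finitely many points, and additive principality keeps the shifted copy inside the box. -/
theorem WidthAtLeast.slabs {b : Fin n → Ordinal.{u}} {o d : Ordinal.{u}} {i j : Fin n}
    (hij : i ≠ j) (hj : IsPrincipal (· + ·) (b j)) (hj' : Order.IsSuccLimit (b j))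
    (h : WidthAtLeast o (ordBox (update b i d))) (k : ℕ) :
    WidthAtLeast (o * k) (ordBox (update b i (d * k))) := by
  induction k with
  | zero =>
    rw [Nat.cast_zero, mul_zero, widthAtLeast_iff]
    exact fun o' ho' => absurd ho' not_lt_zero
  | succ k ih =>
    rw [Nat.cast_succ, mul_add_one, mul_add_one]
    refine WidthAtLeast.add (P := {y ∈ ordBox (update b i (d * k + d)) | d * k ≤ y i}) ?_
      (fun y hy => hy.1) fun F hF => ?_
    · refine h.of_map (fun y => update y i (d * k + y i)) (fun y hy => ⟨fun l => ?_, ?_⟩)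
        fun x _ y _ => (incompRel_update_add_iff _ _ _ _).2
      · have := hy l
        obtain rfl | hl := eq_or_ne l i
        · simpa using this
        · simpa [hl] using this
      · simp
    · obtain ⟨z, hz, hzF⟩ : ∃ z < b j, ∀ p ∈ F, p j < z := by
        refine ⟨F.sup fun p => p j + 1, ?_, fun p hp => ?_⟩
        · rw [Finset.sup_lt_iff hj'.bot_lt]
          intro p hp
          have := (hF hp).1 j
          rw [update_of_ne hij.symm] at this
          exact hj'.add_one_lt this
        · exact (Order.lt_add_one_iff.2 le_rfl).trans_le
            (Finset.le_sup (f := fun p : Fin n → Ordinal.{u} => p j + 1) hp)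
      refine ih.of_map (fun y => update y j (z + y j))
        (fun y hy => ⟨fun l => ?_, fun p hp => ?_⟩)
        fun x _ y _ => (incompRel_update_add_iff _ _ _ _).2
      · beta_reduce
        have := hy l
        obtain rfl | hl := eq_or_ne l j
        · rw [update_of_ne hij.symm] at this ⊢
          rw [update_self]
          exact hj hz this
        · rw [update_of_ne hl]
          refine this.trans_le ?_
          obtain rfl | hl := eq_or_ne l i
          · simp
          · simp [hl]
      · beta_reduce
        refine (incompRel_of_lt_of_lt (i := i) (j := j) ?_ ?_).symm
        · rw [update_of_ne hij]
          have := hy i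
          rw [update_self] at this
          exact this.trans_le (hF hp).2
        · rw [update_self]
          exact (hzF p hp).trans_le le_self_add

theorem wqoWidth_pi_toType_eq {b : Fin n → Ordinal.{u}} {o : Ordinal.{u}}
    (hl : WidthAtLeast o (ordBox b)) (hm : WidthAtMost o (ordBox b)) :
    wqoWidth ((i : Fin n) → (b i).ToType) = o := by
  classical
  have hinc : ∀ x y : (i : Fin n) → (b i).ToType, IncompRel (· ≤ ·) x y ↔
      IncompRel (· ≤ ·) (fun i => ((x i).toOrd : Ordinal.{u}))
        (fun i => ((y i).toOrd : Ordinal.{u})) := by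
    have hle : ∀ x y : (i : Fin n) → (b i).ToType, x ≤ y ↔
        (fun i => ((x i).toOrd : Ordinal.{u})) ≤ fun i => ((y i).toOrd : Ordinal.{u}) := by
      intro x y
      simp [Pi.le_def]
    intro x y
    simp only [IncompRel, hle]
  refine le_antisymm (WidthAtMost.wqoWidth_le ?_) (WidthAtLeast.le_wqoWidth ?_)
  · exact hm.of_map (fun x i => ((x i).toOrd : Ordinal.{u})) (fun x _ i => (x i).toOrd.2)
      fun x _ y _ => (hinc x y).1
  · by_cases hne : ∃ y, y ∈ ordBox b
    · obtain ⟨y₀, h₀⟩ := hne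
      have hmk : ∀ y ∈ ordBox b, (fun i => (ToType.toOrd (ToType.mk
          (if h : y i < b i then ⟨y i, h⟩ else ⟨y₀ i, h₀ i⟩) : (b i).ToType) : Ordinal.{u})) = y := by
        intro y hy
        ext i
        simp [ToType.toOrd, hy i]
      -- The coordinates of `y₀` are dummy values, used only for points outside the box.
      refine hl.of_map (fun y i => ToType.mk
        (if h : y i < b i then ⟨y i, h⟩ else ⟨y₀ i, h₀ i⟩)) (fun y _ => Set.mem_univ _) ?_
      intro x hx y hy h
      rw [hinc, hmk x hx, hmk y hy]
      exact h
    · rw [widthAtLeast_iff] at hl ⊢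
      intro o' ho'
      obtain ⟨x, hx, -⟩ := hl o' ho'
      exact absurd ⟨x, hx⟩ hne

end Box

/-! ### The recursion satisfied by the exponent. -/

section WidthExponent

open Ordinal Function

variable {n : ℕ}

theorem natSum_cons (a : Ordinal.{u}) (l : List Ordinal.{u}) :
    natSum (a :: l) = natAdd a (natSum l) :=
  rfl

theorem natSum_ofFn_succ (α : Fin (n + 1) → Ordinal.{u}) :
    natSum (List.ofFn α) = natAdd (α 0) (natSum (List.ofFn (Fin.tail α))) := by
  rw [List.ofFn_succ, natSum_cons]
  rfl

theorem natSum_ofFn_update_zero (α : Fin (n + 1) → Ordinal.{u}) (c : Ordinal.{u}) :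
    natSum (List.ofFn (update α 0 c)) = natAdd c (natSum (List.ofFn (Fin.tail α))) := by
  rw [natSum_ofFn_succ, Fin.tail_update_zero, update_self]

theorem natSum_ofFn_update_succ (α : Fin (n + 1) → Ordinal.{u}) (i : Fin n) (c : Ordinal.{u}) :
    natSum (List.ofFn (update α i.succ c)) =
      natAdd (α 0) (natSum (List.ofFn (update (Fin.tail α) i c))) := by
  rw [natSum_ofFn_succ, Fin.tail_update_succ, update_of_ne (Fin.succ_ne_zero i).symm]

theorem natSum_ofFn_update_lt {α : Fin n → Ordinal.{u}} {i : Fin n} {c : Ordinal.{u}}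
    (h : c < α i) : natSum (List.ofFn (update α i c)) < natSum (List.ofFn α) := by
  induction n with
  | zero => exact i.elim0
  | succ n ih =>
    rw [natSum_ofFn_succ α]
    cases i using Fin.cases with
    | zero =>
      rw [natSum_ofFn_update_zero]
      exact natAdd_lt_natAdd_left h _
    | succ i =>
      rw [natSum_ofFn_update_succ]
      exact natAdd_lt_natAdd_right _ (ih h)

theorem natSum_ofFn_update_add_one (α : Fin n → Ordinal.{u}) (i : Fin n) (c : Ordinal.{u}) :
    natSum (List.ofFn (update α i (c + 1))) = natSum (List.ofFn (update α i c)) + 1 := by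
  induction n with
  | zero => exact i.elim0
  | succ n ih =>
    cases i using Fin.cases with
    | zero => rw [natSum_ofFn_update_zero, natSum_ofFn_update_zero, add_one_natAdd]
    | succ i => rw [natSum_ofFn_update_succ, natSum_ofFn_update_succ, ih, natAdd_add_one]

theorem exists_le_natSum_ofFn_update {α : Fin n → Ordinal.{u}} {d : Ordinal.{u}}
    (h : d < natSum (List.ofFn α)) :
    ∃ i, ∃ c < α i, d ≤ natSum (List.ofFn (update α i c)) := by
  induction n generalizing d with
  | zero => simp [natSum] at h
  | succ n ih =>
    rw [natSum_ofFn_succ, lt_natAdd_iff] at h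
    obtain ⟨c, hc, h⟩ | ⟨c, hc, h⟩ := h
    · exact ⟨0, c, hc, by rwa [natSum_ofFn_update_zero]⟩
    · obtain ⟨i, c', hc', h'⟩ := ih hc
      refine ⟨i.succ, c', hc', ?_⟩
      rw [natSum_ofFn_update_succ]
      exact h.trans (natAdd_le_natAdd_right _ h')

theorem le_natSum_ofFn (α : Fin n → Ordinal.{u}) (i : Fin n) : α i ≤ natSum (List.ofFn α) := by
  induction n with
  | zero => exact i.elim0
  | succ n ih =>
    rw [natSum_ofFn_succ]
    cases i using Fin.cases with
    | zero => exact le_natAdd_right _ _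
    | succ i => exact (ih (Fin.tail α) i).trans (le_natAdd_left _ _)

theorem natSum_ofFn_zero : natSum (List.ofFn (0 : Fin n → Ordinal.{u})) = 0 := by
  induction n with
  | zero => rfl
  | succ n ih =>
    rw [natSum_ofFn_succ, Pi.zero_apply, zero_natAdd]
    exact ih

theorem natSum_ofFn_of_forall_ne_eq_zero {α : Fin n → Ordinal.{u}} {j : Fin n}
    (h : ∀ k, k ≠ j → α k = 0) : natSum (List.ofFn α) = α j := by
  induction n with
  | zero => exact j.elim0
  | succ n ih =>
    rw [natSum_ofFn_succ]
    cases j using Fin.cases with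
    | zero =>
      have : Fin.tail α = 0 := funext fun k => h k.succ (Fin.succ_ne_zero k)
      rw [this, natSum_ofFn_zero, natAdd_zero]
    | succ j =>
      rw [h 0 (Fin.succ_ne_zero j).symm, zero_natAdd]
      exact ih fun k hk => h k.succ fun hk' => hk (Fin.succ_injective _ hk')

/-- At least two entries of `α` are `≥ c`. -/
def HasTwoGE (c : Ordinal.{u}) (α : Fin n → Ordinal.{u}) : Prop :=
  ∃ i j, i ≠ j ∧ c ≤ α i ∧ c ≤ α j

theorem HasTwoGE.of_le {c d : Ordinal.{u}} {α β : Fin n → Ordinal.{u}} (h : HasTwoGE c α)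
    (hd : d ≤ c) (hαβ : α ≤ β) : HasTwoGE d β := by
  obtain ⟨i, j, hij, hi, hj⟩ := h
  exact ⟨i, j, hij, hd.trans (hi.trans (hαβ i)), hd.trans (hj.trans (hαβ j))⟩

theorem HasTwoGE.exists_ne {c : Ordinal.{u}} {α : Fin n → Ordinal.{u}} (h : HasTwoGE c α)
    (i : Fin n) : ∃ j, j ≠ i ∧ c ≤ α j := by
  obtain ⟨j, k, hjk, hj, hk⟩ := h
  obtain rfl | hji := eq_or_ne j i
  · exact ⟨k, hjk.symm, hk⟩
  · exact ⟨j, hji, hj⟩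

theorem HasTwoGE.update {c d : Ordinal.{u}} {α : Fin n → Ordinal.{u}} (h : HasTwoGE c α)
    {i : Fin n} (hd : c ≤ d) : HasTwoGE c (update α i d) := by
  obtain ⟨j, hj, hc⟩ := h.exists_ne i
  exact ⟨i, j, hj.symm, by simpa using hd, by simpa [hj] using hc⟩

theorem HasTwoGE.update_of_lt {c d : Ordinal.{u}} {α : Fin n → Ordinal.{u}} {i : Fin n}
    (h : HasTwoGE c (Function.update α i d)) (hd : d < c) (d' : Ordinal.{u}) :
    HasTwoGE c (Function.update α i d') := by
  have key : ∀ j, c ≤ Function.update α i d j → c ≤ Function.update α i d' j := by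
    intro j hj
    have hji : j ≠ i := by
      rintro rfl
      rw [update_self] at hj
      exact hd.not_ge hj
    rwa [update_of_ne hji] at hj ⊢
  obtain ⟨j, k, hjk, hj, hk⟩ := h
  exact ⟨j, k, hjk, key j hj, key k hk⟩

open Classical in
/-- The exponent `η` such that the product of the `ω ^ α i` has width `ω ^ η`. -/
noncomputable def prodWidthExp (α : Fin n → Ordinal.{u}) : Ordinal.{u} :=
  if HasTwoGE ω α then natSum (List.ofFn α)
  else if HasTwoGE 1 α then pred (natSum (List.ofFn α)) else 0

theorem prodWidthExp_of_omega0 {α : Fin n → Ordinal.{u}} (h : HasTwoGE ω α) :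
    prodWidthExp α = natSum (List.ofFn α) :=
  if_pos h

theorem prodWidthExp_of_not {α : Fin n → Ordinal.{u}} (h : ¬ HasTwoGE 1 α) :
    prodWidthExp α = 0 := by
  rw [prodWidthExp, if_neg fun h' => h (h'.of_le one_lt_omega0.le le_rfl), if_neg h]

theorem prodWidthExp_add_one {α : Fin n → Ordinal.{u}} (h : HasTwoGE 1 α)
    (h' : ¬ HasTwoGE ω α) : prodWidthExp α + 1 = natSum (List.ofFn α) := by
  rw [prodWidthExp, if_neg h', if_pos h]
  -- A nonzero finite entry makes the natural sum a successor, so `pred` really removes one.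
  obtain ⟨i, hi, hi'⟩ : ∃ i, 1 ≤ α i ∧ α i < ω := by
    obtain ⟨i, j, hij, hi, hj⟩ := h
    by_cases hω : α i < ω
    · exact ⟨i, hi, hω⟩
    · exact ⟨j, hj, lt_of_not_ge fun hω' => h' ⟨i, j, hij, not_lt.1 hω, hω'⟩⟩
  obtain ⟨m, hm⟩ := lt_omega0.1 hi'
  obtain ⟨k, rfl⟩ : ∃ k, m = k + 1 := by
    refine Nat.exists_eq_add_of_le' ?_
    rw [hm] at hi
    exact_mod_cast hi
  have : natSum (List.ofFn α) = natSum (List.ofFn (update α i k)) + 1 := by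
    rw [← natSum_ofFn_update_add_one, ← Nat.cast_succ, ← hm, update_eq_self]
  rw [this, pred_add_one]

theorem prodWidthExp_le (α : Fin n → Ordinal.{u}) : prodWidthExp α ≤ natSum (List.ofFn α) := by
  by_cases h : HasTwoGE ω α
  · rw [prodWidthExp_of_omega0 h]
  by_cases h₁ : HasTwoGE 1 α
  · rw [← prodWidthExp_add_one h₁ h]
    exact le_self_add
  · rw [prodWidthExp_of_not h₁]
    exact zero_le

theorem prodWidthExp_update_lt {α : Fin n → Ordinal.{u}} (h : HasTwoGE 1 α) {i : Fin n}
    {c : Ordinal.{u}} (hc : c < α i) : prodWidthExp (update α i c) < prodWidthExp α := by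
  have hS := natSum_ofFn_update_lt hc
  by_cases hω : HasTwoGE ω α
  · rw [prodWidthExp_of_omega0 hω]
    exact (prodWidthExp_le _).trans_lt hS
  have hle : update α i c ≤ α := update_le_self_iff.2 hc.le
  have hω' : ¬ HasTwoGE ω (update α i c) := fun h' => hω (h'.of_le le_rfl hle)
  rw [← Order.add_one_le_iff, ← Order.lt_add_one_iff, prodWidthExp_add_one h hω]
  by_cases h₁ : HasTwoGE 1 (update α i c)
  · rwa [prodWidthExp_add_one h₁ hω']
  -- The exponent has collapsed to `0`, so the natural sum of `α` must exceed `1`: another nonzero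
  -- entry `α j` survives the lowering, which was strict.
  · rw [prodWidthExp_of_not h₁, zero_add]
    obtain ⟨j, hj, hj'⟩ := h.exists_ne i
    refine (hj'.trans ?_).trans_lt hS
    simpa [hj] using le_natSum_ofFn (update α i c) j

theorem exists_le_prodWidthExp_update {α : Fin n → Ordinal.{u}} (h : HasTwoGE 1 α)
    {d : Ordinal.{u}} (hd : d < prodWidthExp α) :
    ∃ i, ∃ c < α i, d ≤ prodWidthExp (update α i c) := by
  by_cases hω : HasTwoGE ω α
  · rw [prodWidthExp_of_omega0 hω] at hd
    obtain ⟨i, c, hc, hdc⟩ := exists_le_natSum_ofFn_update hd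
    by_cases hω' : HasTwoGE ω (update α i c)
    · exact ⟨i, c, hc, by rwa [prodWidthExp_of_omega0 hω']⟩
    have hcω : c < ω := lt_of_not_ge fun h' => hω' (hω.update h')
    have hi : ω ≤ α i := by
      by_contra! hi
      rw [← update_eq_self i α] at hω
      exact hω' (hω.update_of_lt hi c)
    have hc1 : c + 1 < ω := isSuccLimit_omega0.add_one_lt hcω
    -- Lowering to `c` would leave at most one infinite entry and lose a unit; `c + 1` makes up for
    -- it and is still below the infinite `α i`.
    refine ⟨i, c + 1, hc1.trans_le hi, ?_⟩
    have h₂ := prodWidthExp_add_one (h.update (i := i) (d := c + 1) le_add_self)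
      fun h' => hω' (h'.update_of_lt hc1 c)
    rw [natSum_ofFn_update_add_one] at h₂
    rwa [← Order.lt_add_one_iff, h₂, Order.lt_add_one_iff]
  · have hd' : d + 1 < natSum (List.ofFn α) := by
      rw [← prodWidthExp_add_one h hω]
      exact Order.lt_add_one_iff.2 (Order.add_one_le_iff.2 hd)
    have key : ∀ i, ∀ c < α i, HasTwoGE 1 (update α i c) →
        d + 1 ≤ natSum (List.ofFn (update α i c)) → d ≤ prodWidthExp (update α i c) := by
      intro i c hc h₁ hdc
      have h₂ : ¬ HasTwoGE ω (update α i c) :=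
        fun h' => hω (h'.of_le le_rfl (update_le_self_iff.2 hc.le))
      rw [← prodWidthExp_add_one h₁ h₂, Order.add_one_le_iff, Order.lt_add_one_iff] at hdc
      exact hdc
    obtain ⟨i, c, hc, hdc⟩ := exists_le_natSum_ofFn_update hd'
    by_cases h₁ : HasTwoGE 1 (update α i c)
    · exact ⟨i, c, hc, key i c hc h₁ hdc⟩
    have hi : 1 ≤ α i := Order.one_le_iff_pos.2 ((zero_le).trans_lt hc)
    obtain rfl | hd0 := eq_or_ne d 0
    · exact ⟨i, c, hc, zero_le⟩
    obtain ⟨j, hj, hj1⟩ := h.exists_ne i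
    have hS : natSum (List.ofFn (update α i c)) = α j := by
      rw [natSum_ofFn_of_forall_ne_eq_zero (j := j), update_of_ne hj]
      intro k hk
      by_contra hk0
      refine h₁ ⟨j, k, hk.symm, ?_, Order.one_le_iff_ne_zero.2 hk0⟩
      rwa [update_of_ne hj]
    have hdj : d < α j := by rwa [hS, Order.add_one_le_iff] at hdc
    -- Lowering `i` leaves only `α j` nonzero, a chain. Lowering `j` to `d` instead keeps the
    -- positive entry `α i`, which supplies the missing unit.
    refine ⟨j, d, hdj, key j d hdj (h.update (Order.one_le_iff_ne_zero.2 hd0)) ?_⟩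
    rw [Order.add_one_le_iff]
    have hlt : 0 < update α j d i := by
      rw [update_of_ne hj.symm]
      exact (zero_le).trans_lt hc
    refine lt_of_le_of_lt ?_ (natSum_ofFn_update_lt hlt)
    simpa [hj] using le_natSum_ofFn (update (update α j d) i 0) j

/-! ### The two width bounds for products of powers of `ω`. -/

theorem update_opow (α : Fin n → Ordinal.{u}) (i : Fin n) (c : Ordinal.{u}) :
    update (fun j => (ω ^ α j : Ordinal.{u})) i (ω ^ c) = fun j => ω ^ update α i c j := by
  ext j
  obtain rfl | h := eq_or_ne j i <;> simp [*]

theorem widthAtMost_ordBox_opow (α : Fin n → Ordinal.{u}) :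
    WidthAtMost (ω ^ prodWidthExp α) (ordBox fun i => ω ^ α i) := by
  induction α using WellFoundedLT.induction with
  | ind α ih =>
  rw [widthAtMost_iff]
  intro x hx
  have hzero : ∀ i y, y ∈ ordBox (fun i => (ω ^ α i : Ordinal.{u})) → ∀ c, c < y i →
      1 ≤ α i := by
    intro i y hy c hc
    rw [Order.one_le_iff_ne_zero]
    intro h0
    have : y i < ω ^ α i := hy i
    rw [h0, opow_zero, Order.lt_one_iff] at this
    rw [this] at hc
    exact not_lt_zero hc
  by_cases h : HasTwoGE 1 α
  · have hS : ∀ i, ∃ o < ω ^ prodWidthExp α,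
        WidthAtMost o {y ∈ ordBox (fun i => (ω ^ α i : Ordinal.{u})) | y i < x i} := by
      intro i
      by_cases h0 : α i = 0
      · refine ⟨0, opow_pos _ omega0_pos, widthAtMost_zero_empty.mono ?_⟩
        rintro y ⟨-, hy⟩
        have := hzero i x hx _ hy
        simp [h0] at this
      · obtain ⟨c, hc, k, hk⟩ := (lt_omega0_opow h0).1 (hx i)
        have hw := ih (update α i c) (update_lt_self_iff.2 hc)
        rw [← update_opow] at hw
        obtain ⟨o, ho, ho'⟩ := exists_widthAtMost_slabs (e := prodWidthExp α)
          ((opow_lt_opow_iff_right one_lt_omega0).2 (prodWidthExp_update_lt h hc)) hw k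
        exact ⟨o, ho, ho'.mono fun y hy => ⟨hy.1, hy.2.trans hk⟩⟩
    obtain ⟨o, ho, ho'⟩ := exists_widthAtMost_biUnion Finset.univ _ fun i _ => hS i
    refine ⟨o, ho, ho'.mono ?_⟩
    rintro y ⟨hy, hxy⟩
    obtain ⟨i, -, -, hi, -⟩ := exists_lt_of_incompRel hxy
    simp only [Set.mem_iUnion]
    exact ⟨i, Finset.mem_univ i, hy, hi⟩
  -- Incomparable points differ strictly in two coordinates, both with nonzero exponent; here there
  -- are none, so the first move ends the play.
  · refine ⟨0, opow_pos _ omega0_pos, widthAtMost_zero_empty.mono ?_⟩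
    rintro y ⟨hy, hxy⟩
    obtain ⟨i, j, hij, hi, hj⟩ := exists_lt_of_incompRel hxy
    exact h ⟨i, j, hij, hzero i x hx _ hi, hzero j y hy _ hj⟩

theorem widthAtLeast_ordBox_opow (α : Fin n → Ordinal.{u}) :
    WidthAtLeast (ω ^ prodWidthExp α) (ordBox fun i => ω ^ α i) := by
  induction α using WellFoundedLT.induction with
  | ind α ih =>
  rw [widthAtLeast_iff]
  intro o' ho'
  by_cases h : HasTwoGE 1 α
  · have h0 : prodWidthExp α ≠ 0 := by
      obtain ⟨i, -, -, hi, -⟩ := id h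
      exact (prodWidthExp_update_lt h (zero_lt_one.trans_le hi)).ne_bot
    obtain ⟨d, hd, k, hk⟩ := (lt_omega0_opow h0).1 ho'
    obtain ⟨i, c, hc, hdc⟩ := exists_le_prodWidthExp_update h hd
    obtain ⟨j, hj, hj'⟩ := h.exists_ne i
    have hw := ih (update α i c) (update_lt_self_iff.2 hc)
    rw [← update_opow] at hw
    have hs := (hw.slabs hj.symm (isPrincipal_add_omega0_opow _)
      (isSuccLimit_opow_left isSuccLimit_omega0 (Order.one_le_iff_ne_zero.1 hj')) k).mono
      (T := ordBox fun i => ω ^ α i) ?_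
    · refine widthAtLeast_iff.1 hs o' (hk.trans_le ?_)
      exact mul_le_mul_left (opow_le_opow_right omega0_pos hdc) _
    · intro y hy l
      refine (hy l).trans_le ?_
      obtain rfl | hl := eq_or_ne l i
      · rw [update_self]
        exact (opow_mul_lt_opow (natCast_lt_omega0 k) hc).le
      · rw [update_of_ne hl]
  · rw [prodWidthExp_of_not h, opow_zero, Order.lt_one_iff] at ho'
    subst ho'
    exact ⟨0, fun i => opow_pos _ omega0_pos,
      widthAtLeast_iff.2 fun o' ho' => absurd ho' not_lt_zero⟩

theorem wqoWidth_pi_opow (α : Fin n → Ordinal.{u}) :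
    wqoWidth ((i : Fin n) → (ω ^ α i : Ordinal.{u}).ToType) = ω ^ prodWidthExp α :=
  wqoWidth_pi_toType_eq (widthAtLeast_ordBox_opow α) (widthAtMost_ordBox_opow α)

theorem natSum_eq_sum_of_lt_omega0 (l : List Ordinal.{u}) (hl : ∀ a ∈ l, a < ω) :
    natSum l = l.sum ∧ l.sum < ω := by
  induction l with
  | nil => exact ⟨rfl, omega0_pos⟩
  | cons a l ih =>
    obtain ⟨h, h'⟩ := ih fun b hb => hl b (List.mem_cons_of_mem _ hb)
    rw [natSum_cons, h, List.sum_cons]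
    refine ⟨?_, isPrincipal_add_omega0 (hl a List.mem_cons_self) h'⟩
    obtain ⟨m, hm⟩ := lt_omega0.1 h'
    rw [hm, natAdd_natCast]

end WidthExponent

/-! ### Matching the exponent with the closed formulas. -/

theorem omega0_le_natSum_ofFn_iff_exists {n : ℕ} (α : Fin n → Ordinal.{u}) :
    Ordinal.omega0 ≤ natSum (List.ofFn α) ↔ ∃ i, Ordinal.omega0 ≤ α i := by
  refine ⟨fun h => ?_, fun ⟨i, hi⟩ => hi.trans (le_natSum_ofFn α i)⟩
  by_contra! hα
  obtain ⟨h₁, h₂⟩ := natSum_eq_sum_of_lt_omega0 (List.ofFn α) fun a ha => by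
    obtain ⟨i, rfl⟩ := List.mem_ofFn.1 ha
    exact hα i
  exact h.not_gt (h₁ ▸ h₂)

/-- The width of `ω ^ α₁ × ⋯ × ω ^ αₙ` with the componentwise order, for `n ≥ 2` and
`α₁ ≥ ⋯ ≥ αₙ > 0`. The list `α₁, …, αₙ` is `List.ofFn α`, so `α₁` is `α ⟨0, _⟩` and `(List.ofFn α).tail` is
the list `α₂, …, αₙ`. Subtraction is left subtraction: `1 + (a - 1) = a` for `a ≥ 1`. -/
theorem mainTheorem1 (n : ℕ) (hn : 2 ≤ n) (α : Fin n → Ordinal.{u}) (hα : Antitone α)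
    (hpos : ∀ i, 0 < α i) (η : Ordinal.{u})
    (hη : η = natAdd (α ⟨0, by omega⟩) (natSum (List.ofFn α).tail - 1)) :
    wqoWidth ((i : Fin n) → (Ordinal.omega0 ^ α i).ToType) = Ordinal.omega0 ^ η ∧
    ((∀ i, α i < Ordinal.omega0) →
      (List.ofFn α).sum = natSum (List.ofFn α) ∧ η = (List.ofFn α).sum - 1) ∧
    (Ordinal.omega0 ≤ α ⟨0, by omega⟩ → (∀ i : Fin n, 1 ≤ i.1 → α i < Ordinal.omega0) →
      (List.ofFn α).tail.sum = natSum (List.ofFn α).tail ∧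
      η = α ⟨0, by omega⟩ + ((List.ofFn α).tail.sum - 1)) ∧
    ((∃ i j : Fin n, i ≠ j ∧ Ordinal.omega0 ≤ α i ∧ Ordinal.omega0 ≤ α j) →
      η = natSum (List.ofFn α)) := by
  obtain ⟨n, rfl⟩ : ∃ m, n = m + 1 := Nat.exists_eq_add_of_le' (by omega)
  have h0 : (⟨0, by omega⟩ : Fin (n + 1)) = 0 := rfl
  have htail : (List.ofFn α).tail = List.ofFn (Fin.tail α) := by
    rw [List.ofFn_succ]
    rfl
  rw [h0] at hη ⊢
  rw [htail] at hη ⊢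
  have hone : ∀ i, 1 ≤ α i := fun i => Order.one_le_iff_pos.2 (hpos i)
  have htwo : HasTwoGE 1 α :=
    ⟨⟨0, by omega⟩, ⟨1, by omega⟩, by simp, hone _, hone _⟩
  -- Since `α 0` is the largest entry, an infinite entry in the tail forces a second one at `0`.
  have htwo_iff : HasTwoGE Ordinal.omega0 α ↔ ∃ i, Ordinal.omega0 ≤ Fin.tail α i := by
    constructor
    · intro h
      obtain ⟨j, hj, hj'⟩ := h.exists_ne 0
      obtain ⟨i, rfl⟩ := Fin.exists_succ_eq.2 hj
      exact ⟨i, hj'⟩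
    · rintro ⟨i, hi⟩
      exact ⟨0, i.succ, (Fin.succ_ne_zero i).symm, hi.trans (hα (Fin.zero_le _)), hi⟩
  have hinf : HasTwoGE Ordinal.omega0 α → η = natSum (List.ofFn α) := by
    intro h
    rw [htwo_iff, ← omega0_le_natSum_ofFn_iff_exists] at h
    -- Left subtraction of `1` does not change an infinite ordinal.
    rw [hη, natSum_ofFn_succ, Ordinal.sub_eq_of_add_eq (Ordinal.one_add_of_omega0_le h)]
  have hfin : (∀ i, Fin.tail α i < Ordinal.omega0) → ∃ m : ℕ,
      (List.ofFn (Fin.tail α)).sum = (m + 1 : ℕ) ∧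
      natSum (List.ofFn (Fin.tail α)) = (m + 1 : ℕ) ∧ η = α 0 + m := by
    intro h
    obtain ⟨h₁, h₂⟩ := natSum_eq_sum_of_lt_omega0 (List.ofFn (Fin.tail α)) fun a ha => by
      obtain ⟨i, rfl⟩ := List.mem_ofFn.1 ha
      exact h i
    obtain ⟨k, hk⟩ := Ordinal.lt_omega0.1 h₂
    have hk1 : (1 : Ordinal.{u}) ≤ natSum (List.ofFn (Fin.tail α)) :=
      (hone (Fin.succ ⟨0, by omega⟩)).trans (le_natSum_ofFn (Fin.tail α) ⟨0, by omega⟩)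
    obtain ⟨m, rfl⟩ : ∃ m, k = m + 1 := by
      refine Nat.exists_eq_add_of_le' ?_
      rw [h₁, hk] at hk1
      exact_mod_cast hk1
    refine ⟨m, hk, h₁.trans hk, ?_⟩
    have : ((m + 1 : ℕ) : Ordinal.{u}) - 1 = m :=
      Ordinal.sub_eq_of_add_eq (by rw [add_comm m 1]; exact_mod_cast rfl)
    rw [hη, h₁, hk, this, natAdd_natCast]
  refine ⟨?_, fun h => ?_, fun _ h => ?_, fun h => hinf h⟩
  · rw [wqoWidth_pi_opow]
    congr 1
    by_cases h : HasTwoGE Ordinal.omega0 α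
    · rw [hinf h, prodWidthExp_of_omega0 h]
    · obtain ⟨m, -, hm, hηm⟩ := hfin (by simpa [htwo_iff] using h)
      have := prodWidthExp_add_one htwo h
      rw [natSum_ofFn_succ, hm, natAdd_natCast, Nat.cast_succ, ← add_assoc, ← hηm] at this
      exact Order.add_one_inj.1 this
  · have hS := (natSum_eq_sum_of_lt_omega0 (List.ofFn α) fun a ha => by
      obtain ⟨i, rfl⟩ := List.mem_ofFn.1 ha
      exact h i).1
    refine ⟨hS.symm, ?_⟩
    obtain ⟨m, hm, -, hηm⟩ := hfin fun i => h i.succ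
    have hsum : (List.ofFn α).sum = α 0 + (m + 1 : ℕ) := by
      rw [← hm, List.ofFn_succ, List.sum_cons]
      rfl
    obtain ⟨k, hk⟩ := Ordinal.lt_omega0.1 (h 0)
    rw [hsum, hηm, hk]
    refine (Ordinal.sub_eq_of_add_eq ?_).symm
    norm_cast
    omega
  · obtain ⟨m, hm, hm', hηm⟩ := hfin fun i => h i.succ (by simp)
    refine ⟨hm.trans hm'.symm, ?_⟩
    rw [hηm, hm, Ordinal.sub_eq_of_add_eq (c := ((m + 1 : ℕ) : Ordinal.{u})) (b := m)]
    norm_cast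
    omega
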